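/- A continuum is a nonempty compact connected metric space, and it is nondegenerate if it has more than one point; a subcontinuum of $X$ is a nonempty compact connected subset of $X$. A continuum $X$ is - irreducible if there are two points $a,b\in X$ such that every subcontinuum of $X$ containing both $a$ and $b$ equals $X$; - a Wilder continuum if for any three distinct points $x,y,z\in X$ there is a subcontinuum $C\subseteq X$ such that $x\in C$ and $C$ contains exactly one of $y$ and $z$; - a $D^*$-continuum if for any two disjoint nondegenerate subcontinua $A,B\subseteq X$ there is a subcontinuum $C\subseteq X$ with $A\cap C\neq\emptyset\neq B\cap C$, $A\setminus C\neq\emptyset$ and $B\setminus C\neq\emptyset$; - a $D^{**}$-continuum if for any two disjoint nondegenerate subcontinua $A,B\subseteq X$ there is a subcontinuum $C\subseteq X$ with $A\cap C\neq\emptyset\neq B\cap C$ and $B\setminus C\neq\emptyset$; - an arc if it is homeomorphic to $[0,1]$; - arc-like if for every $\varepsilon>0$ there is a continuous surjection $f\colon X\to[0,1]$ with $\operatorname{diam} f^{-1}(y)<\varepsilon$ for all $y\in[0,1]$. Corollary 3.3. Let $X$ be a nondegenerate continuum. Then the following are equivalent: 1. $X$ is an irreducible Wilder continuum; 2. $X$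 is an irreducible $D^*$-continuum; 3. $X$ is an irreducible $D^{**}$-continuum; 4. $X$ is an arc. Moreover, if $X$ is an arc-like $D^*$-continuum, then $X$ is an arc. (Thus there is no arc-like $D^*$-continuum which is not an arc.) -/

import Mathlib

/-- A subcontinuum of `X`: a nonempty, compact, connected subset. -/
def IsSubcontinuum {X : Type*} [TopologicalSpace X] (C : Set X) : Prop :=
  IsCompact C ∧ IsConnected C

/-- `X` is irreducible between `a` and `b`: no proper subcontinuum contains both points. -/
def IsIrreducibleBetween {X : Type*} [TopologicalSpace X] (a b : X) : Prop :=
  ∀ C : Set X, IsSubcontinuum C → a ∈ C → b ∈ C → C = Set.univ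

/-- `X` is irreducible between some two (distinct) points. -/
def IsIrreducibleContinuum (X : Type*) [TopologicalSpace X] : Prop :=
  ∃ a b : X, a ≠ b ∧ IsIrreducibleBetween a b

/-- Wilder continua: for three distinct points `x, y, z` there is a subcontinuum that contains `x`
and exactly one of `y` and `z`. -/
def IsWilderContinuum (X : Type*) [TopologicalSpace X] : Prop :=
  ∀ x y z : X, x ≠ y → y ≠ z → x ≠ z →
    ∃ C : Set X, IsSubcontinuum C ∧ x ∈ C ∧ ((y ∈ C ∧ z ∉ C) ∨ (y ∉ C ∧ z ∈ C))

/-- `D*`-continua: any two disjoint nondegenerate subcontinua are both met, and neither of them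
is contained, by some subcontinuum. -/
def IsDStarContinuum (X : Type*) [TopologicalSpace X] : Prop :=
  ∀ A B : Set X, IsSubcontinuum A → IsSubcontinuum B → A.Nontrivial → B.Nontrivial →
    Disjoint A B →
    ∃ C : Set X, IsSubcontinuum C ∧ (A ∩ C).Nonempty ∧ (B ∩ C).Nonempty ∧
      (A \ C).Nonempty ∧ (B \ C).Nonempty

/-- `D**`-continua: as for `D*`, but only the second subcontinuum must not be contained. -/
def IsDStarStarContinuum (X : Type*) [TopologicalSpace X] : Prop :=
  ∀ A B : Set X, IsSubcontinuum A → IsSubcontinuum B → A.Nontrivial → B.Nontrivial →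
    Disjoint A B →
    ∃ C : Set X, IsSubcontinuum C ∧ (A ∩ C).Nonempty ∧ (B ∩ C).Nonempty ∧ (B \ C).Nonempty

/-- An arc: a space homeomorphic to the closed interval `[0, 1]`. -/
def IsArc (X : Type*) [TopologicalSpace X] : Prop :=
  Nonempty (X ≃ₜ unitInterval)

/-- Arc-like: for every `ε > 0` there is a continuous surjection onto `[0, 1]` all of whose fibers
have diameter less than `ε`. -/
def IsArcLike (X : Type*) [MetricSpace X] : Prop :=
  ∀ ε : ℝ, 0 < ε → ∃ f : X → unitInterval, Continuous f ∧ Function.Surjective f ∧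
    ∀ y : unitInterval, Metric.diam (f ⁻¹' {y}) < ε

/-!
Each of the first three conditions implies that `X` is an irreducible `D**`-continuum: the Wilder
condition, applied to a point of `A` and two points of `B`, yields the continuum required by `D**`.
Arcs have all the properties, as is seen with subintervals of `[0, 1]`.

Let `X` be a `D**`-continuum that is irreducible between `a` and `b`. The complement of a
subcontinuum through `a` is connected (`isPreconnected_diff_of_irreducible`). Together with `D**`
this shows that the boundary of such a subcontinuum contains no nondegenerate continuum
(`IsIrreducibleBetween.not_subset_closure_compl`), and by boundary bumping that the subcontinua
through `a` form a chain in which smaller members lie in the interior of larger ones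
(`IsIrreducibleBetween.subset_interior_or_subset`). Hence there is a least subcontinuum
`continuumHull a x` containing `a` and `x`. By `D**` it determines `x`
(`IsIrreducibleBetween.continuumHull_injective`), so inclusion of hulls is a linear order on `X`.
Its rays are closed, and a compact metric space with such an order embeds monotonically into the
real line, by a weighted sum of running suprema of distance functions
(`exists_continuous_strictMono`).

An arc-like continuum is always irreducible (`IsArcLike.isIrreducibleContinuum`). Maps to `[0, 1]`
with small fibers show that intersecting subcontinua have connected intersection, so that hulls of
pairs of points exist, and that one of any three points lies in the hull of the other two
(`IsArcLike.mem_hull_or`). Fix `p` and preorder `X` by inclusion of the hulls with `p`. An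
unbounded chain would produce a continuum `F`, the common closure of all its late tails, for which
proper subcontinua through a suitable point `z` have empty interior in `F`; Baire's theorem then
gives a point `w` such that `F` is the hull of `z` and `w`, and `w` bounds the chain after all
(`IsArcLike.exists_upper_bound`). So Zorn's lemma provides a point `m` that is maximal as seen from
`p`, and then a point `m'` that is maximal as seen from `m`; the hull of `m` and `m'` is `X`.
-/

open Set Topology

/-! ### Subcontinua of compact Hausdorff spaces -/

section Subcontinua

variable {X : Type*} [TopologicalSpace X]

theorem IsSubcontinuum.isPreconnected {C : Set X} (hC : IsSubcontinuum C) : IsPreconnected C :=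
  hC.2.isPreconnected

theorem IsSubcontinuum.isClosed [T2Space X] {C : Set X} (hC : IsSubcontinuum C) : IsClosed C :=
  hC.1.isClosed

theorem IsClosed.isSubcontinuum [CompactSpace X] {C : Set X} (hC : IsClosed C) (hne : C.Nonempty)
    (hpre : IsPreconnected C) : IsSubcontinuum C :=
  ⟨hC.isCompact, hne, hpre⟩

theorem IsPreconnected.isSubcontinuum_closure [CompactSpace X] {C : Set X}
    (hpre : IsPreconnected C) (hne : C.Nonempty) : IsSubcontinuum (closure C) :=
  isClosed_closure.isSubcontinuum hne.closure hpre.closure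

theorem IsSubcontinuum.union {A B : Set X} (hA : IsSubcontinuum A) (hB : IsSubcontinuum B)
    (h : (A ∩ B).Nonempty) : IsSubcontinuum (A ∪ B) :=
  ⟨hA.1.union hB.1, hA.2.union h hB.2⟩

theorem IsSubcontinuum.ordConnected_image {C : Set X} (hC : IsSubcontinuum C)
    {f : X → unitInterval} (hf : Continuous f) : OrdConnected (f '' C) :=
  (hC.isPreconnected.image f hf.continuousOn).ordConnected

theorem isSubcontinuum_singleton (x : X) : IsSubcontinuum {x} :=
  ⟨isCompact_singleton, isConnected_singleton⟩

theorem isSubcontinuum_univ [CompactSpace X] [ConnectedSpace X] :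
    IsSubcontinuum (univ : Set X) :=
  ⟨isCompact_univ, isConnected_univ⟩

/-- The intersection of a downward directed family of subcontinua is connected: a separation of
the intersection would already separate a member of the family. -/
theorem isSubcontinuum_sInter_of_directedOn [CompactSpace X] [T2Space X] {S : Set (Set X)}
    (hne : S.Nonempty) (hS : ∀ C ∈ S, IsSubcontinuum C) (hdir : DirectedOn (· ⊇ ·) S) :
    IsSubcontinuum (⋂₀ S) := by
  have hcl : IsClosed (⋂₀ S) := isClosed_sInter fun C hC => (hS C hC).isClosed
  have : Nonempty S := hne.to_subtype
  refine hcl.isSubcontinuum (IsCompact.nonempty_sInter_of_directed_nonempty_isCompact_isClosed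
    hdir (fun C hC => (hS C hC).2.nonempty) (fun C hC => (hS C hC).1)
    (fun C hC => (hS C hC).isClosed)) ?_
  rw [isPreconnected_iff_subset_of_fully_disjoint_closed hcl]
  intro P Q hP hQ hsub hPQ
  obtain ⟨U, V, hU, hV, hPU, hQV, hUV⟩ := normal_separation hP hQ hPQ
  obtain ⟨⟨C, hC⟩, hCUV⟩ := exists_subset_nhds_of_isCompact (V := fun C : S => (C : Set X))
    (U := U ∪ V) (directedOn_iff_directed.1 hdir)
    (fun C => (hS C C.2).1)
    (fun x hx => (hU.union hV).mem_nhds (by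
      rw [← sInter_eq_iInter] at hx
      exact (hsub hx).imp (fun h => hPU h) (fun h => hQV h)))
  have hSC : ⋂₀ S ⊆ C := sInter_subset_of_mem hC
  rcases (hS C hC).isPreconnected.subset_or_subset hU hV hUV hCUV with h | h
  · left
    intro x hx
    exact (hsub hx).resolve_right fun hxQ => disjoint_left.1 hUV (h (hSC hx)) (hQV hxQ)
  · right
    intro x hx
    exact (hsub hx).resolve_left fun hxP => disjoint_left.1 hUV (hPU hxP) (h (hSC hx))

/-- The intersection of all subcontinua that contain `p` and `x`. Where these subcontinua are
closed under binary intersections, it is the least subcontinuum that contains `p` and `x`. -/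
def continuumHull (p x : X) : Set X :=
  ⋂₀ {C | IsSubcontinuum C ∧ p ∈ C ∧ x ∈ C}

theorem left_mem_continuumHull (p x : X) : p ∈ continuumHull p x := fun _ hC => hC.2.1

theorem right_mem_continuumHull (p x : X) : x ∈ continuumHull p x := fun _ hC => hC.2.2

theorem continuumHull_subset {p x : X} {C : Set X} (hC : IsSubcontinuum C) (hp : p ∈ C)
    (hx : x ∈ C) : continuumHull p x ⊆ C :=
  sInter_subset_of_mem ⟨hC, hp, hx⟩

theorem continuumHull_comm (p x : X) : continuumHull p x = continuumHull x p := by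
  unfold continuumHull
  congr 1
  ext C
  simp only [mem_ofPred_eq]
  tauto

theorem continuumHull_self (p : X) : continuumHull p p = {p} :=
  (continuumHull_subset (isSubcontinuum_singleton p) rfl rfl).antisymm
    (singleton_subset_iff.2 (left_mem_continuumHull p p))

theorem isSubcontinuum_continuumHull [CompactSpace X] [T2Space X] [ConnectedSpace X] {p x : X}
    (h : ∀ C D : Set X, IsSubcontinuum C → IsSubcontinuum D → p ∈ C → p ∈ D → x ∈ C → x ∈ D →
      IsSubcontinuum (C ∩ D)) :
    IsSubcontinuum (continuumHull p x) := by
  refine isSubcontinuum_sInter_of_directedOn ⟨univ, isSubcontinuum_univ, trivial, trivial⟩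
    (fun C hC => hC.1) ?_
  rintro C ⟨hC, hpC, hxC⟩ D ⟨hD, hpD, hxD⟩
  exact ⟨C ∩ D, ⟨h C D hC hD hpC hpD hxC hxD, ⟨hpC, hpD⟩, ⟨hxC, hxD⟩⟩, inter_subset_left,
    inter_subset_right⟩

/-- If `Y` is irreducible between `p` and `s`, then removing a subcontinuum through `p` leaves a
connected set: otherwise one could add to that subcontinuum the part of the remainder that
contains `s`, and omit the other part. -/
theorem isPreconnected_diff_of_irreducible [CompactSpace X] [T2Space X] {Y C : Set X} {p s : X}
    (hY : IsSubcontinuum Y) (hirr : ∀ D : Set X, IsSubcontinuum D → p ∈ D → s ∈ D → Y ⊆ D)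
    (hs : s ∈ Y) (hC : IsSubcontinuum C) (hCY : C ⊆ Y) (hp : p ∈ C) : IsPreconnected (Y \ C) := by
  -- A separated open part of the complement, together with `C`, is a subcontinuum.
  have key : ∀ U V : Set X, IsOpen U → IsOpen V → Y \ C ⊆ U ∪ V → Y \ C ∩ (U ∩ V) = ∅ →
      IsSubcontinuum (C ∪ (Y \ C) ∩ U) := by
    intro U V hU hV hsub hdisj
    have hcl : ∀ U V : Set X, IsOpen U → IsOpen V → Y \ C ⊆ U ∪ V → Y \ C ∩ (U ∩ V) = ∅ →
        IsClosed (C ∪ (Y \ C) ∩ U) := by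
      intro U V hU hV hsub hdisj
      have : C ∪ (Y \ C) ∩ U = Y ∩ (V \ C)ᶜ := by
        ext x
        have h1 := @hsub x
        have h2 : ¬ x ∈ Y \ C ∩ (U ∩ V) := by simp [hdisj]
        have h3 := @hCY x
        simp only [mem_union, mem_inter_iff, mem_sdiff, mem_compl_iff] at *
        tauto
      rw [this]
      exact hY.isClosed.inter (hV.sdiff hC.isClosed).isClosed_compl
    have hclU := hcl U V hU hV hsub hdisj
    have hclV := hcl V U hV hU (by rwa [union_comm V U]) (by rwa [inter_comm V U])
    refine hclU.isSubcontinuum ⟨p, Or.inl hp⟩ ?_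
    have main : ∀ P Q : Set X, IsClosed P → IsClosed Q → C ∪ (Y \ C) ∩ U ⊆ P ∪ Q → Disjoint P Q →
        C ⊆ P → C ∪ (Y \ C) ∩ U ⊆ P := by
      intro P Q hP hQ hPQ hd hCP
      have hYsub : Y ⊆ ((C ∪ (Y \ C) ∩ U) ∩ P ∪ (C ∪ (Y \ C) ∩ V)) ∪ ((C ∪ (Y \ C) ∩ U) ∩ Q) := by
        intro x hx
        have h1 := @hsub x
        have h2 := @hPQ x
        simp only [mem_union, mem_inter_iff, mem_sdiff] at *
        tauto
      have hdis : Disjoint ((C ∪ (Y \ C) ∩ U) ∩ P ∪ (C ∪ (Y \ C) ∩ V)) ((C ∪ (Y \ C) ∩ U) ∩ Q) := by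
        rw [disjoint_left] at hd ⊢
        intro x
        have h1 := @hd x
        have h2 : ¬ x ∈ Y \ C ∩ (U ∩ V) := by simp [hdisj]
        have h3 := @hCP x
        simp only [mem_union, mem_inter_iff, mem_sdiff] at *
        tauto
      have := (isPreconnected_iff_subset_of_fully_disjoint_closed hY.isClosed).1
        hY.isPreconnected _ _ ((hclU.inter hP).union hclV) (hclU.inter hQ) hYsub hdis
      rcases this with h | h
      · intro x hx
        by_contra hxP
        have h1 := @hPQ x hx
        have h2 : x ∈ Y := hx.elim (fun h => hCY h) (fun h => h.1.1)
        exact disjoint_left.1 hdis (h h2) ⟨hx, h1.resolve_left hxP⟩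
      · exact absurd (h (hCY hp)).2 (disjoint_left.1 hd (hCP hp))
    rw [isPreconnected_iff_subset_of_fully_disjoint_closed hclU]
    intro P Q hP hQ hPQ hd
    rcases (isPreconnected_iff_subset_of_fully_disjoint_closed hC.isClosed).1
      hC.isPreconnected P Q hP hQ (subset_union_left.trans hPQ) hd with h | h
    · exact Or.inl (main P Q hP hQ hPQ hd h)
    · exact Or.inr (main Q P hQ hP (by rwa [union_comm Q P]) hd.symm h)
  rw [isPreconnected_iff_subset_of_disjoint]
  intro U V hU hV hsub hdisj
  by_cases hsC : s ∈ C
  · exact Or.inl fun x hx => absurd (hirr C hC hp hsC hx.1) hx.2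
  rcases hsub ⟨hs, hsC⟩ with h | h
  · left
    intro x hx
    exact ((hirr _ (key U V hU hV hsub hdisj) (Or.inl hp) (Or.inr ⟨⟨hs, hsC⟩, h⟩) hx.1).resolve_left
      hx.2).2
  · right
    intro x hx
    exact ((hirr _ (key V U hV hU (by rwa [union_comm V U]) (by rwa [inter_comm V U])) (Or.inl hp)
      (Or.inr ⟨⟨hs, hsC⟩, h⟩) hx.1).resolve_left hx.2).2

/-- Boundary bumping in a compact connected space: a neighbourhood of a point contains a
nondegenerate subcontinuum through the point. If the component of the point in a closed
neighbourhood were trivial, a clopen subset of that neighbourhood would be clopen in the space. -/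
theorem exists_nontrivial_subcontinuum_of_isOpen [CompactSpace X] [T2Space X] [ConnectedSpace X]
    [Nontrivial X] {U : Set X} (hU : IsOpen U) {x : X} (hx : x ∈ U) :
    ∃ T : Set X, IsSubcontinuum T ∧ T.Nontrivial ∧ x ∈ T ∧ T ⊆ U := by
  obtain ⟨y, hy⟩ := exists_ne x
  obtain ⟨N, hN, hNcl, hNU⟩ := exists_mem_nhds_isClosed_subset
    ((hU.inter isOpen_compl_singleton).mem_nhds ⟨hx, fun h : x = y => hy h.symm⟩)
  have hxN : x ∈ N := mem_of_mem_nhds hN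
  have : CompactSpace N := isCompact_iff_compactSpace.1 hNcl.isCompact
  let x' : N := ⟨x, hxN⟩
  have hTcl : IsClosed ((↑) '' connectedComponent x' : Set X) :=
    hNcl.isClosedEmbedding_subtypeVal.isClosedMap _ isClosed_connectedComponent
  refine ⟨(↑) '' connectedComponent x', hTcl.isSubcontinuum ⟨x, x', mem_connectedComponent, rfl⟩
    (isPreconnected_connectedComponent.image _ continuous_subtype_val.continuousOn), ?_,
    ⟨x', mem_connectedComponent, rfl⟩, ?_⟩
  · by_contra hnt
    have hsing : connectedComponent x' = {x'} := by
      apply Subsingleton.eq_singleton_of_mem _ mem_connectedComponent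
      intro u hu v hv
      exact Subtype.ext (not_nontrivial_iff.1 hnt ⟨u, hu, rfl⟩ ⟨v, hv, rfl⟩)
    rw [connectedComponent_eq_iInter_isClopen] at hsing
    have hW : IsOpen ((↑) ⁻¹' interior N : Set N) :=
      isOpen_interior.preimage continuous_subtype_val
    have hne : Nonempty {s : Set N // IsClopen s ∧ x' ∈ s} := ⟨univ, isClopen_univ, trivial⟩
    obtain ⟨⟨Q, hQ, hxQ⟩, hQW⟩ := exists_subset_nhds_of_isCompact
      (V := fun s : {s : Set N // IsClopen s ∧ x' ∈ s} => s.1) (U := (↑) ⁻¹' interior N)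
      (fun s t => ⟨⟨s.1 ∩ t.1, s.2.1.inter t.2.1, s.2.2, t.2.2⟩, inter_subset_left,
        inter_subset_right⟩)
      (fun s => s.2.1.isClosed.isCompact)
      (fun z hz => hW.mem_nhds (by
        rw [hsing] at hz
        rw [mem_singleton_iff.1 hz]
        exact mem_interior_iff_mem_nhds.2 hN))
    obtain ⟨O, hO, hOQ⟩ := isOpen_induced_iff.1 hQ.isOpen
    have himg : ((↑) '' Q : Set X) = O ∩ interior N := by
      ext z
      constructor
      · rintro ⟨q, hq, rfl⟩
        exact ⟨by rw [← hOQ] at hq; exact hq, hQW hq⟩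
      · rintro ⟨hzO, hzN⟩
        exact ⟨⟨z, interior_subset hzN⟩, by rw [← hOQ]; exact hzO, rfl⟩
    have hclopen : IsClopen ((↑) '' Q : Set X) :=
      ⟨hNcl.isClosedEmbedding_subtypeVal.isClosedMap _ hQ.isClosed,
        himg ▸ hO.inter isOpen_interior⟩
    have huniv := hclopen.eq_univ ⟨x, x', hxQ, rfl⟩
    obtain ⟨q, -, hq⟩ : y ∈ ((↑) '' Q : Set X) := huniv ▸ trivial
    exact (hNU (hq ▸ q.2)).2 rfl
  · rintro _ ⟨z, -, rfl⟩
    exact (hNU z.2).1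

/-- Boundary bumping inside a nondegenerate subcontinuum. -/
theorem IsSubcontinuum.exists_nontrivial_subset [T2Space X] {K U : Set X}
    (hK : IsSubcontinuum K) (hKn : K.Nontrivial) (hU : IsOpen U) {x : X} (hxK : x ∈ K)
    (hx : x ∈ U) :
    ∃ T : Set X, IsSubcontinuum T ∧ T.Nontrivial ∧ x ∈ T ∧ T ⊆ U ∧ T ⊆ K := by
  have : CompactSpace K := isCompact_iff_compactSpace.1 hK.1
  have : ConnectedSpace K := isConnected_iff_connectedSpace.1 hK.2
  have : Nontrivial K := hKn.coe_sort
  obtain ⟨T, hT, hTn, hxT, hTU⟩ := exists_nontrivial_subcontinuum_of_isOpen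
    (hU.preimage (continuous_subtype_val : Continuous ((↑) : K → X))) (x := ⟨x, hxK⟩) hx
  refine ⟨(↑) '' T, ⟨hT.1.image continuous_subtype_val,
    hT.2.image _ continuous_subtype_val.continuousOn⟩, hTn.image Subtype.val_injective,
    ⟨_, hxT, rfl⟩, ?_, ?_⟩
  · rintro _ ⟨z, hz, rfl⟩
    exact hTU hz
  · rintro _ ⟨z, -, rfl⟩
    exact z.2

end Subcontinua

/-! ### Ordered continua are arcs -/

section OrderedContinua

variable {X : Type*}

/-- The running supremum of a continuous function along a linear order with closed rays is
continuous. No relation between the topology and the order beyond closed rays is needed: the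
superlevel set `{c < ·}` is the union of an open set and of open rays, and the set `{c ≤ ·}` is
a closed ray by compactness. -/
theorem continuous_sSup_image_Iic [TopologicalSpace X] [CompactSpace X] [LinearOrder X]
    [ClosedIicTopology X] [ClosedIciTopology X] {φ : X → ℝ} (hφ : Continuous φ) :
    Continuous fun x => sSup (φ '' Iic x) := by
  have hbdd : ∀ x, BddAbove (φ '' Iic x) := fun x =>
    (isClosed_Iic.isCompact.image hφ).bddAbove
  have hne : ∀ x, (φ '' Iic x).Nonempty := fun x => ⟨φ x, x, le_rfl, rfl⟩
  have hlt : ∀ c x, c < sSup (φ '' Iic x) ↔ ∃ z, z ≤ x ∧ c < φ z := by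
    intro c x
    rw [lt_csSup_iff (hbdd x) (hne x)]
    simp
  have hge : ∀ c x, c ≤ sSup (φ '' Iic x) ↔ ∃ z, z ≤ x ∧ c ≤ φ z := by
    intro c x
    constructor
    · intro h
      obtain ⟨z, hz, hzs⟩ := (isClosed_Iic.isCompact.image hφ).sSup_mem (hne x)
      exact ⟨z, hz, by rwa [hzs]⟩
    · rintro ⟨z, hz, hcz⟩
      exact hcz.trans (le_csSup (hbdd x) ⟨z, hz, rfl⟩)
  refine continuous_iff_lower_upperSemicontinuous.2 ⟨?_, ?_⟩
  · rw [lowerSemicontinuous_iff_isOpen_preimage]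
    intro c
    have : (fun x => sSup (φ '' Iic x)) ⁻¹' Ioi c =
        φ ⁻¹' Ioi c ∪ ⋃ z ∈ φ ⁻¹' Ioi c, Ioi z := by
      ext x
      simp only [mem_preimage, mem_Ioi, hlt, mem_union, mem_iUnion, exists_prop]
      constructor
      · rintro ⟨z, hz, hcz⟩
        rcases hz.eq_or_lt with rfl | hz
        · exact Or.inl hcz
        · exact Or.inr ⟨z, hcz, hz⟩
      · rintro (h | ⟨z, hcz, hz⟩)
        · exact ⟨x, le_rfl, h⟩
        · exact ⟨z, hz.le, hcz⟩
    rw [this]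
    exact (isOpen_Ioi.preimage hφ).union (isOpen_biUnion fun z _ => isOpen_Ioi)
  · rw [upperSemicontinuous_iff_isClosed_preimage]
    intro c
    rcases (φ ⁻¹' Ici c).eq_empty_or_nonempty with hemp | hnemp
    · have : (fun x => sSup (φ '' Iic x)) ⁻¹' Ici c = ∅ := by
        ext x
        simp only [mem_preimage, mem_Ici, hge, mem_empty_iff_false, iff_false]
        rintro ⟨z, -, hz⟩
        exact (hemp ▸ (show z ∈ φ ⁻¹' Ici c from hz) : z ∈ (∅ : Set X))
      rw [this]
      exact isClosed_empty
    · obtain ⟨m, hm, hmin⟩ := (isClosed_Ici.preimage hφ).isCompact.exists_isLeast hnemp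
      have : (fun x => sSup (φ '' Iic x)) ⁻¹' Ici c = Ici m := by
        ext x
        simp only [mem_preimage, mem_Ici, hge]
        exact ⟨fun ⟨z, hz, hcz⟩ => (hmin hcz).trans hz, fun h => ⟨m, h, hm⟩⟩
      rw [this]
      exact isClosed_Ici

/-- A compact metric space with a linear order whose rays are closed has a continuous strictly
monotone function. Along a dense sequence `d`, the terms of the series are the (negated, truncated)
distances from `d i` to the initial segments; they are monotone, and one of them tells apart
any two given initial segments. -/
theorem exists_continuous_strictMono [MetricSpace X] [CompactSpace X] [Nonempty X] [LinearOrder X]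
    [ClosedIicTopology X] [ClosedIciTopology X] :
    ∃ f : X → ℝ, Continuous f ∧ StrictMono f := by
  let d := TopologicalSpace.denseSeq X
  let φ : ℕ → X → ℝ := fun i z => max (-dist z (d i)) (-1)
  have hφc : ∀ i, Continuous (φ i) := fun i => by fun_prop
  let g : ℕ → X → ℝ := fun i x => sSup (φ i '' Iic x)
  have hgc : ∀ i, Continuous (g i) := fun i => continuous_sSup_image_Iic (hφc i)
  have hbdd : ∀ i x, BddAbove (φ i '' Iic x) := fun i x =>
    (isClosed_Iic.isCompact.image (hφc i)).bddAbove
  have hne : ∀ i x, (φ i '' Iic x).Nonempty := fun i x => ⟨_, x, le_rfl, rfl⟩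
  have hgmono : ∀ i, Monotone (g i) := fun i x y hxy =>
    csSup_le_csSup (hbdd i y) (hne i x) (image_mono (Iic_subset_Iic.2 hxy))
  have hφ0 : ∀ i z, φ i z ≤ 0 := fun i z => by simp [φ]
  have hg0 : ∀ i x, g i x ≤ 0 := fun i x => csSup_le (hne i x) (by
    rintro _ ⟨z, -, rfl⟩
    exact hφ0 i z)
  have hg1 : ∀ i x, -1 ≤ g i x := fun i x =>
    (le_max_right _ _ : -1 ≤ φ i x).trans (le_csSup (hbdd i x) ⟨x, le_rfl, rfl⟩)
  have hnorm : ∀ i x, ‖(1 / 2 : ℝ) ^ i * g i x‖ ≤ (1 / 2 : ℝ) ^ i := by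
    intro i x
    rw [norm_mul, norm_pow, Real.norm_of_nonneg (by norm_num : (0 : ℝ) ≤ 1 / 2)]
    refine mul_le_of_le_one_right (by positivity) ?_
    rw [Real.norm_eq_abs, abs_le]
    exact ⟨hg1 i x, (hg0 i x).trans zero_le_one⟩
  have hsum : ∀ x, Summable fun i => (1 / 2 : ℝ) ^ i * g i x := fun x =>
    Summable.of_norm_bounded summable_geometric_two (fun i => hnorm i x)
  refine ⟨fun x => ∑' i, (1 / 2 : ℝ) ^ i * g i x,
    continuous_tsum (fun i => (hgc i).const_mul _) summable_geometric_two hnorm, ?_⟩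
  intro x y hxy
  -- A ball around `y` misses the initial segment of `x`.
  obtain ⟨ε, hε, hball⟩ := Metric.isOpen_iff.1 (isClosed_Iic (a := x)).isOpen_compl y
    (show y ∉ Iic x from not_le.2 hxy)
  obtain ⟨i, hi⟩ := (TopologicalSpace.denseRange_denseSeq X).exists_dist_lt y
    (show 0 < min (ε / 2) 1 by positivity)
  have hi1 : dist y (d i) < ε / 2 := hi.trans_le (min_le_left _ _)
  have hi2 : dist y (d i) < 1 := hi.trans_le (min_le_right _ _)
  have hlt : g i x < g i y := by
    obtain ⟨z, hz, hzs⟩ := (isClosed_Iic.isCompact.image (hφc i)).sSup_mem (hne i x)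
    have h1 : φ i y ≤ g i y := le_csSup (hbdd i y) ⟨y, le_rfl, rfl⟩
    refine lt_of_lt_of_le ?_ h1
    rw [show g i x = φ i z from hzs.symm]
    have h2 : ε ≤ dist z y := by
      by_contra hlt
      exact hball (Metric.mem_ball.2 (not_le.1 hlt)) hz
    have h3 := dist_triangle z (d i) y
    rw [dist_comm (d i) y] at h3
    exact max_lt (lt_max_of_lt_left (by linarith)) (lt_max_of_lt_left (by linarith))
  exact Summable.tsum_lt_tsum (i := i)
    (fun j => mul_le_mul_of_nonneg_left (hgmono j hxy.le) (by positivity))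
    (mul_lt_mul_of_pos_left hlt (by positivity)) (hsum x) (hsum y)

/-- A continuum that maps continuously and injectively into the real line is an arc. -/
theorem isArc_of_continuous_injective [TopologicalSpace X] [CompactSpace X] [ConnectedSpace X]
    [Nontrivial X] {f : X → ℝ} (hf : Continuous f) (hinj : Function.Injective f) : IsArc X := by
  obtain ⟨m, M, hmM⟩ : ∃ m M : ℝ, range f = Icc m M := by
    refine ⟨sInf (range f), sSup (range f), eq_Icc_of_connected_compact ?_ (isCompact_range hf)⟩
    exact isConnected_range hf
  have hlt : m < M := by
    obtain ⟨x, y, hxy⟩ := exists_pair_ne X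
    have hx : f x ∈ Icc m M := hmM ▸ mem_range_self x
    have hy : f y ∈ Icc m M := hmM ▸ mem_range_self y
    by_contra hle
    exact hinj.ne hxy (by linarith [hx.1, hx.2, hy.1, hy.2])
  exact ⟨((hf.isClosedEmbedding hinj).isEmbedding.toHomeomorph.trans
    (Homeomorph.setCongr hmM)).trans (iccHomeoI m M hlt)⟩

theorem isArc_of_linearOrder [MetricSpace X] [CompactSpace X] [ConnectedSpace X] [Nontrivial X]
    [LinearOrder X] [ClosedIicTopology X] [ClosedIciTopology X] : IsArc X := by
  obtain ⟨f, hf, hmono⟩ := exists_continuous_strictMono (X := X)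
  exact isArc_of_continuous_injective hf hmono.injective

end OrderedContinua

/-! ### Irreducible `D**`-continua are arcs -/

section Irreducible

variable {X : Type*} [TopologicalSpace X] [CompactSpace X] [T2Space X] [ConnectedSpace X]
  {a b : X}

theorem IsIrreducibleBetween.isPreconnected_compl (h : IsIrreducibleBetween a b) {K : Set X}
    (hK : IsSubcontinuum K) (ha : a ∈ K) : IsPreconnected Kᶜ := by
  rw [compl_eq_univ_sdiff]
  exact isPreconnected_diff_of_irreducible isSubcontinuum_univ
    (fun D hD haD hbD => (h D hD haD hbD).ge) (mem_univ b) hK (subset_univ K) ha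

theorem IsIrreducibleBetween.isSubcontinuum_closure_compl (h : IsIrreducibleBetween a b)
    {K : Set X} (hK : IsSubcontinuum K) (ha : a ∈ K) (hb : b ∉ K) :
    IsSubcontinuum (closure Kᶜ) :=
  (h.isPreconnected_compl hK ha).isSubcontinuum_closure ⟨b, hb⟩

/-- Of two subcontinua through the end `a`, one lies in the interior of the other, or it contains
the interior of the other. -/
theorem IsIrreducibleBetween.subset_interior_or (h : IsIrreducibleBetween a b) {K K' : Set X}
    (hK : IsSubcontinuum K) (ha : a ∈ K) (hK' : IsSubcontinuum K') (ha' : a ∈ K') :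
    K' ⊆ interior K ∨ interior K ⊆ K' := by
  by_cases hb : b ∈ K
  · left
    rw [h K hK ha hb, interior_univ]
    exact subset_univ _
  rcases (K' ∩ closure Kᶜ).eq_empty_or_nonempty with hemp | hne
  · left
    rw [interior_eq_compl_closure_compl]
    exact fun x hx hxL => (hemp ▸ ⟨hx, hxL⟩ : x ∈ (∅ : Set X))
  · right
    have huniv := h _ (hK'.union (h.isSubcontinuum_closure_compl hK ha hb) hne) (Or.inl ha')
      (Or.inr (subset_closure hb))
    intro x hx
    rw [interior_eq_compl_closure_compl] at hx
    have : x ∈ K' ∪ closure Kᶜ := huniv ▸ mem_univ x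
    exact this.resolve_right hx

variable [Nontrivial X]

/-- The boundary of a subcontinuum `K` through the end `a` contains no nondegenerate continuum
`E`: a continuum from `E` to a small continuum around `b` covers, together with the latter, the
complement of `K` and hence `E`. -/
theorem IsIrreducibleBetween.not_subset_closure_compl (h : IsIrreducibleBetween a b)
    (hD : IsDStarStarContinuum X) {K E : Set X} (hK : IsSubcontinuum K) (ha : a ∈ K)
    (hE : IsSubcontinuum E) (hEn : E.Nontrivial) (hEK : E ⊆ K) : ¬ E ⊆ closure Kᶜ := by
  intro hEL
  have hb : b ∉ K := by
    intro hb
    obtain ⟨x, hx⟩ := hE.2.nonempty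
    simpa [h K hK ha hb] using hEL hx
  obtain ⟨B, hB, hBn, hbB, hBK⟩ :=
    exists_nontrivial_subcontinuum_of_isOpen hK.isClosed.isOpen_compl (x := b) hb
  have hdisj : Disjoint B E := disjoint_left.2 fun x hxB hxE => hBK hxB (hEK hxE)
  obtain ⟨C, hC, hBC, ⟨e, heE, heC⟩, t, htE, htC⟩ := hD B E hB hE hBn hEn hdisj
  have huniv := h _ ((hB.union hC hBC).union hK ⟨e, Or.inr heC, hEK heE⟩) (Or.inr ha)
    (Or.inl (Or.inl hbB))
  have hsub : closure Kᶜ ⊆ B ∪ C := closure_minimal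
    (fun x hx => (show x ∈ B ∪ C ∪ K from huniv ▸ mem_univ x).resolve_right hx)
    (hB.union hC hBC).isClosed
  exact (hsub (hEL htE)).elim (fun hB' => disjoint_left.1 hdisj hB' htE) htC

theorem IsIrreducibleBetween.subset_closure_interior (h : IsIrreducibleBetween a b)
    (hD : IsDStarStarContinuum X) {K : Set X} (hK : IsSubcontinuum K) (ha : a ∈ K)
    (hKn : K.Nontrivial) : K ⊆ closure (interior K) := by
  intro x hx
  by_contra hxc
  obtain ⟨T, hT, hTn, -, hTU, hTK⟩ :=
    hK.exists_nontrivial_subset hKn isClosed_closure.isOpen_compl hx hxc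
  refine h.not_subset_closure_compl hD hK ha hT hTn hTK fun y hy => ?_
  by_contra hyL
  rw [← mem_compl_iff, ← interior_eq_compl_closure_compl] at hyL
  exact hTU hy (subset_closure hyL)

/-- The subcontinua through the end `a` form a chain, in which smaller members lie in the
interior of larger ones. -/
theorem IsIrreducibleBetween.subset_interior_or_subset (h : IsIrreducibleBetween a b)
    (hD : IsDStarStarContinuum X) {K K' : Set X} (hK : IsSubcontinuum K) (ha : a ∈ K)
    (hK' : IsSubcontinuum K') (ha' : a ∈ K') : K' ⊆ interior K ∨ K ⊆ K' := by
  by_cases hKn : K.Nontrivial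
  · refine (h.subset_interior_or hK ha hK' ha').imp_right fun hsub => ?_
    exact (h.subset_closure_interior hD hK ha hKn).trans (closure_minimal hsub hK'.isClosed)
  · right
    intro x hx
    rwa [not_nontrivial_iff.1 hKn hx ha]

theorem IsIrreducibleBetween.isSubcontinuum_hull (h : IsIrreducibleBetween a b)
    (hD : IsDStarStarContinuum X) (x : X) : IsSubcontinuum (continuumHull a x) := by
  refine isSubcontinuum_continuumHull fun C D hC hD' haC haD _ _ => ?_
  rcases h.subset_interior_or_subset hD hC haC hD' haD with hsub | hsub
  · rwa [inter_eq_self_of_subset_right (hsub.trans interior_subset)]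
  · rwa [inter_eq_self_of_subset_left hsub]

/-- Distinct points have distinct hulls with the end `a`. Otherwise take a small continuum `T`
around one of the points, in the common hull, and a continuum `K'` through `a` that meets `T` but
does not contain it. Then `K' ∪ T` contains the hull, and so `K'` contains the other point,
the hull, and `T`. -/
theorem IsIrreducibleBetween.continuumHull_injective (h : IsIrreducibleBetween a b)
    (hD : IsDStarStarContinuum X) : Function.Injective (continuumHull a) := by
  have key : ∀ x y : X, x ≠ a → x ≠ y → continuumHull a x ≠ continuumHull a y := by
    intro x y hxa hxy heq
    obtain ⟨T, hT, hTn, hxT, hTU, hTK⟩ :=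
      (h.isSubcontinuum_hull hD x).exists_nontrivial_subset
      ⟨x, right_mem_continuumHull a x, a, left_mem_continuumHull a x, hxa⟩
      (isOpen_compl_singleton (x := a) |>.inter (isOpen_compl_singleton (x := y)))
      (right_mem_continuumHull a x) ⟨hxa, hxy⟩
    have haT : a ∉ T := fun ha => (hTU ha).1 rfl
    have hyT : y ∉ T := fun hy => (hTU hy).2 rfl
    obtain ⟨A, hA, hAn, haA, hAT⟩ :=
      exists_nontrivial_subcontinuum_of_isOpen hT.isClosed.isOpen_compl (x := a) haT
    have hdisj : Disjoint A T := disjoint_left.2 hAT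
    obtain ⟨C, hC, hAC, ⟨e, heT, heC⟩, t, htT, htC⟩ := hD A T hA hT hAn hTn hdisj
    have hyK : y ∈ A ∪ C := by
      have := continuumHull_subset ((hA.union hC hAC).union hT ⟨e, Or.inr heC, heT⟩)
        (Or.inl (Or.inl haA)) (Or.inr hxT)
      rw [heq] at this
      exact (this (right_mem_continuumHull a y)).resolve_right hyT
    have htK : t ∈ A ∪ C :=
      continuumHull_subset (hA.union hC hAC) (Or.inl haA) hyK (heq ▸ hTK htT)
    exact htK.elim (fun htA => hAT htA htT) htC
  intro x y heq
  by_contra hxy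
  by_cases hxa : x = a
  · exact key y x (fun hya => hxy (hxa.trans hya.symm)) (fun hyx => hxy hyx.symm) heq.symm
  · exact key x y hxa hxy heq

end Irreducible

/-- An irreducible `D**`-continuum is an arc: `x ≤ y` if and only if every subcontinuum that
contains the end `a` and `y` also contains `x` defines a linear order with closed rays. -/
theorem isArc_of_irreducible_of_dStarStar {X : Type*} [MetricSpace X] [CompactSpace X]
    [ConnectedSpace X] [Nontrivial X] (hirr : IsIrreducibleContinuum X)
    (hD : IsDStarStarContinuum X) : IsArc X := by
  obtain ⟨a, b, -, h⟩ := hirr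
  have hsub := h.isSubcontinuum_hull hD
  have hle : ∀ {x y : X}, x ∈ continuumHull a y → continuumHull a x ⊆ continuumHull a y :=
    fun {x y} hxy => continuumHull_subset (hsub y) (left_mem_continuumHull a y) hxy
  have hdich : ∀ x z : X, continuumHull a z ⊆ interior (continuumHull a x) ∨
      x ∈ continuumHull a z := fun x z =>
    (h.subset_interior_or_subset hD (hsub x) (left_mem_continuumHull a x) (hsub z)
      (left_mem_continuumHull a z)).imp_right fun hxz => hxz (right_mem_continuumHull a x)
  let _ : LinearOrder X :=
    { le := fun x y => x ∈ continuumHull a y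
      le_refl := right_mem_continuumHull a
      le_trans := fun x y z hxy hyz => hle hyz hxy
      le_antisymm := fun x y hxy hyx =>
        h.continuumHull_injective hD ((hle hxy).antisymm (hle hyx))
      le_total := fun x y => ((hdich y x).imp_left fun hs =>
        interior_subset (hs (right_mem_continuumHull a x)))
      toDecidableLE := Classical.decRel _ }
  have : ClosedIicTopology X := ⟨fun x => (hsub x).isClosed⟩
  have : ClosedIciTopology X := by
    refine ⟨fun x => ?_⟩
    have : Ici x = {x} ∪ closure (continuumHull a x)ᶜ := by
      ext z
      constructor
      · intro hz
        by_cases hzx : z ∈ continuumHull a x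
        · exact Or.inl (le_antisymm (α := X) hzx hz)
        · exact Or.inr (subset_closure hzx)
      · rintro (hz | hz)
        · exact (mem_singleton_iff.1 hz).ge
        · refine (hdich x z).resolve_left fun hs => ?_
          have := hs (right_mem_continuumHull a z)
          rw [interior_eq_compl_closure_compl] at this
          exact this hz
    rw [this]
    exact isClosed_singleton.union isClosed_closure
  exact isArc_of_linearOrder

/-! ### Implications between the properties, and the properties of arcs -/

theorem IsDStarContinuum.isDStarStarContinuum {X : Type*} [TopologicalSpace X]
    (h : IsDStarContinuum X) : IsDStarStarContinuum X := by
  intro A B hA hB hAn hBn hAB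
  obtain ⟨C, hC, hAC, hBC, -, hBC'⟩ := h A B hA hB hAn hBn hAB
  exact ⟨C, hC, hAC, hBC, hBC'⟩

/-- The Wilder condition for a point of `A` and two points of `B` gives the continuum that the
`D**` condition asks for. -/
theorem IsWilderContinuum.isDStarStarContinuum {X : Type*} [TopologicalSpace X]
    (h : IsWilderContinuum X) : IsDStarStarContinuum X := by
  rintro A B hA - - ⟨y, hy, z, hz, hyz⟩ hAB
  obtain ⟨x, hx⟩ := hA.2.nonempty
  obtain ⟨C, hC, hxC, ⟨hyC, hzC⟩ | ⟨hyC, hzC⟩⟩ := h x y z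
    (fun e => disjoint_left.1 hAB hx (e ▸ hy)) hyz (fun e => disjoint_left.1 hAB hx (e ▸ hz))
  · exact ⟨C, hC, ⟨x, hx, hxC⟩, ⟨y, hy, hyC⟩, ⟨z, hz, hzC⟩⟩
  · exact ⟨C, hC, ⟨x, hx, hxC⟩, ⟨z, hz, hzC⟩, ⟨y, hy, hyC⟩⟩

section Arcs

variable {X : Type*} [TopologicalSpace X]

theorem Homeomorph.isSubcontinuum_preimage_uIcc (h : X ≃ₜ unitInterval) (s t : unitInterval) :
    IsSubcontinuum (h ⁻¹' uIcc s t) := by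
  refine ⟨h.isCompact_preimage.2 isCompact_uIcc, ⟨h.symm s, by simp⟩, ?_⟩
  exact h.isPreconnected_preimage.2 isPreconnected_uIcc

theorem IsArc.isIrreducibleContinuum (hX : IsArc X) : IsIrreducibleContinuum X := by
  obtain ⟨h⟩ := hX
  refine ⟨h.symm 0, h.symm 1, h.symm.injective.ne zero_ne_one, fun C hC h0 h1 => ?_⟩
  refine eq_univ_of_forall fun x => ?_
  obtain ⟨y, hy, hyx⟩ := (hC.ordConnected_image h.continuous).out ⟨_, h0, h.apply_symm_apply 0⟩
    ⟨_, h1, h.apply_symm_apply 1⟩ (show h x ∈ Icc 0 1 from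
      ⟨unitInterval.nonneg', unitInterval.le_one'⟩)
  exact h.injective hyx ▸ hy

theorem IsArc.isWilderContinuum (hX : IsArc X) : IsWilderContinuum X := by
  obtain ⟨h⟩ := hX
  intro x y z hxy hyz hxz
  by_cases hz : h z ∈ uIcc (h x) (h y)
  · refine ⟨h ⁻¹' uIcc (h x) (h z), h.isSubcontinuum_preimage_uIcc _ _, left_mem_uIcc,
      Or.inr ⟨fun hy => hyz (h.injective ?_), right_mem_uIcc⟩⟩
    rw [uIcc_comm] at hz hy
    exact eq_of_mem_uIcc_of_mem_uIcc hy hz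
  · exact ⟨h ⁻¹' uIcc (h x) (h y), h.isSubcontinuum_preimage_uIcc _ _, left_mem_uIcc,
      Or.inl ⟨right_mem_uIcc, hz⟩⟩

theorem IsArc.isDStarContinuum (hX : IsArc X) : IsDStarContinuum X := by
  obtain ⟨h⟩ := hX
  intro A B hA hB hAn hBn hAB
  obtain ⟨_, ⟨a₁, ha₁, rfl⟩, _, ⟨a₂, ha₂, rfl⟩, ha⟩ := (hAn.image h.injective).exists_lt
  obtain ⟨_, ⟨b₁, hb₁, rfl⟩, _, ⟨b₂, hb₂, rfl⟩, hb⟩ := (hBn.image h.injective).exists_lt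
  by_cases h₁ : h a₂ < h b₁
  · refine ⟨h ⁻¹' uIcc (h a₂) (h b₁), h.isSubcontinuum_preimage_uIcc _ _,
      ⟨a₂, ha₂, left_mem_uIcc⟩, ⟨b₁, hb₁, right_mem_uIcc⟩, ⟨a₁, ha₁, ?_⟩, ⟨b₂, hb₂, ?_⟩⟩
    · rw [mem_preimage, uIcc_of_le h₁.le]
      exact fun hm => hm.1.not_gt ha
    · rw [mem_preimage, uIcc_of_le h₁.le]
      exact fun hm => hm.2.not_gt hb
  by_cases h₂ : h b₂ < h a₁
  · refine ⟨h ⁻¹' uIcc (h b₂) (h a₁), h.isSubcontinuum_preimage_uIcc _ _,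
      ⟨a₁, ha₁, right_mem_uIcc⟩, ⟨b₂, hb₂, left_mem_uIcc⟩, ⟨a₂, ha₂, ?_⟩, ⟨b₁, hb₁, ?_⟩⟩
    · rw [mem_preimage, uIcc_of_le h₂.le]
      exact fun hm => hm.2.not_gt ha
    · rw [mem_preimage, uIcc_of_le h₂.le]
      exact fun hm => hm.1.not_gt hb
  · -- The intervals spanned by the two pairs overlap, against the disjointness of `A` and `B`.
    exfalso
    obtain ⟨u, hu, hux⟩ := (hA.ordConnected_image h.continuous).out ⟨a₁, ha₁, rfl⟩ ⟨a₂, ha₂, rfl⟩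
      (show max (h a₁) (h b₁) ∈ Icc (h a₁) (h a₂) from
        ⟨le_max_left _ _, max_le ha.le (not_lt.1 h₁)⟩)
    obtain ⟨v, hv, hvx⟩ := (hB.ordConnected_image h.continuous).out ⟨b₁, hb₁, rfl⟩ ⟨b₂, hb₂, rfl⟩
      (show max (h a₁) (h b₁) ∈ Icc (h b₁) (h b₂) from
        ⟨le_max_right _ _, max_le (not_lt.1 h₂) hb.le⟩)
    exact disjoint_left.1 hAB hu (h.injective (hux.trans hvx.symm) ▸ hv)

end Arcs

/-! ### Subcontinua of arc-like continua -/

theorem IsCompact.exists_pos_forall_le_dist {X : Type*} [PseudoMetricSpace X] {A B : Set X}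
    (hA : IsCompact A) (hB : IsClosed B) (h : Disjoint A B) :
    ∃ ε > 0, ∀ a ∈ A, ∀ b ∈ B, ε ≤ dist a b := by
  obtain ⟨ε, hε, hd⟩ := h.exists_thickenings hA hB
  refine ⟨ε, hε, fun a ha b hb => ?_⟩
  by_contra hlt
  exact disjoint_left.1 hd
    (Metric.mem_thickening_iff.2 ⟨a, ha, by rw [dist_comm]; exact not_le.1 hlt⟩)
    (Metric.self_subset_thickening hε B hb)

section ArcLike

variable {X : Type*} [MetricSpace X] [CompactSpace X]

theorem IsArcLike.exists_small_fibers (hX : IsArcLike X) {ε : ℝ} (hε : 0 < ε) :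
    ∃ f : X → unitInterval, Continuous f ∧ ∀ x y, f x = f y → dist x y < ε := by
  obtain ⟨f, hf, -, hd⟩ := hX ε hε
  exact ⟨f, hf, fun x y hxy => (Metric.dist_le_diam_of_mem
    (isCompact_univ.isBounded.subset (subset_univ _)) (show x ∈ f ⁻¹' {f y} from hxy) rfl).trans_lt
    (hd (f y))⟩

/-- Arc-like continua are hereditarily unicoherent. If `f` has small fibers, then every point of
the interval `f '' A ∩ f '' B` comes from a point of `A` close to `A ∩ B`; hence a separation
of `A ∩ B` would induce a separation of this interval. -/
theorem IsArcLike.isSubcontinuum_inter (hX : IsArcLike X) {A B : Set X} (hA : IsSubcontinuum A)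
    (hB : IsSubcontinuum B) (hne : (A ∩ B).Nonempty) : IsSubcontinuum (A ∩ B) := by
  have hcl : IsClosed (A ∩ B) := hA.isClosed.inter hB.isClosed
  refine hcl.isSubcontinuum hne ?_
  rw [isPreconnected_iff_subset_of_fully_disjoint_closed hcl]
  intro P Q hP hQ hsub hPQ
  by_contra! hcon
  obtain ⟨q, hq, hqP⟩ := not_subset.1 hcon.1
  obtain ⟨r, hr, hrQ⟩ := not_subset.1 hcon.2
  have hqQ := (hsub hq).resolve_left hqP
  have hrP := (hsub hr).resolve_right hrQ
  have hP' : IsClosed (A ∩ B ∩ P) := hcl.inter hP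
  have hQ' : IsClosed (A ∩ B ∩ Q) := hcl.inter hQ
  obtain ⟨δ, hδ, hdis⟩ :=
    (hPQ.mono inter_subset_right inter_subset_right : Disjoint (A ∩ B ∩ P) (A ∩ B ∩ Q)
      ).exists_cthickenings hP'.isCompact hQ'
  have hPcl := Metric.isClosed_cthickening (δ := δ) (E := A ∩ B ∩ P)
  have hQcl := Metric.isClosed_cthickening (δ := δ) (E := A ∩ B ∩ Q)
  obtain ⟨ε₁, hε₁, h₁⟩ := hPcl.isCompact.exists_pos_forall_le_dist hQcl hdis
  let W := Metric.thickening δ (A ∩ B ∩ P) ∪ Metric.thickening δ (A ∩ B ∩ Q)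
  have hW : IsOpen W := Metric.isOpen_thickening.union Metric.isOpen_thickening
  have hABW : A ∩ B ⊆ W := fun x hx => (hsub hx).imp
    (fun h => Metric.self_subset_thickening hδ _ ⟨hx, h⟩)
    (fun h => Metric.self_subset_thickening hδ _ ⟨hx, h⟩)
  obtain ⟨ε₂, hε₂, h₂⟩ := (hA.1.diff hW).exists_pos_forall_le_dist hB.isClosed
    (disjoint_left.2 fun x hx hxB => hx.2 (hABW ⟨hx.1, hxB⟩))
  obtain ⟨f, hf, hfd⟩ := hX.exists_small_fibers (lt_min hε₁ hε₂)
  let J := f '' A ∩ f '' B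
  have hJ : IsPreconnected J :=
    ((hA.ordConnected_image hf).inter
      (hB.ordConnected_image hf)).isPreconnected
  have hJP : IsClosed (f '' (A ∩ Metric.cthickening δ (A ∩ B ∩ P))) :=
    ((hA.isClosed.inter hPcl).isCompact.image hf).isClosed
  have hJQ : IsClosed (f '' (A ∩ Metric.cthickening δ (A ∩ B ∩ Q))) :=
    ((hA.isClosed.inter hQcl).isCompact.image hf).isClosed
  obtain ⟨_, -, ⟨u, hu, rfl⟩, v, hv, huv⟩ := isPreconnected_closed_iff.1 hJ _ _ hJP hJQ (by
      rintro _ ⟨⟨x, hxA, rfl⟩, y, hyB, hxy⟩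
      have hxW : x ∈ W := by
        by_contra hxW
        exact (h₂ x ⟨hxA, hxW⟩ y hyB).not_gt
          ((hfd x y hxy.symm).trans_le (min_le_right _ _))
      exact hxW.imp
        (fun h => ⟨x, ⟨hxA, Metric.thickening_subset_cthickening _ _ h⟩, rfl⟩)
        (fun h => ⟨x, ⟨hxA, Metric.thickening_subset_cthickening _ _ h⟩, rfl⟩))
    ⟨f r, ⟨⟨r, hr.1, rfl⟩, r, hr.2, rfl⟩, r,
      ⟨hr.1, Metric.self_subset_cthickening _ ⟨hr, hrP⟩⟩, rfl⟩
    ⟨f q, ⟨⟨q, hq.1, rfl⟩, q, hq.2, rfl⟩, q,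
      ⟨hq.1, Metric.self_subset_cthickening _ ⟨hq, hqQ⟩⟩, rfl⟩
  exact (h₁ u hu.2 v hv.2).not_gt ((hfd u v huv.symm).trans_le (min_le_left _ _))

/-- One of any three points lies in every continuum that contains the other two, namely one
whose image lies between the other images under maps with arbitrarily small fibers. -/
theorem IsArcLike.mem_hull_or (hX : IsArcLike X) (x y z : X) :
    x ∈ continuumHull y z ∨ y ∈ continuumHull x z ∨ z ∈ continuumHull x y := by
  have sep : ∀ u v w : X, u ∉ continuumHull v w → ∃ ε > 0, ∀ f : X → unitInterval, Continuous f →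
      (∀ x y, f x = f y → dist x y < ε) → f u ∉ uIcc (f v) (f w) := by
    intro u v w hu
    simp only [continuumHull, mem_sInter, not_forall] at hu
    obtain ⟨C, ⟨hC, hv, hw⟩, huC⟩ := hu
    obtain ⟨ε, hε, h⟩ := isCompact_singleton.exists_pos_forall_le_dist hC.isClosed
      (disjoint_singleton_left.2 huC)
    refine ⟨ε, hε, fun f hf hfd hmem => ?_⟩
    obtain ⟨c, hc, hcu⟩ := (hC.ordConnected_image hf).uIcc_subset
      ⟨v, hv, rfl⟩ ⟨w, hw, rfl⟩ hmem
    exact (h u rfl c hc).not_gt (hfd u c hcu.symm)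
  by_contra! hcon
  obtain ⟨hx, hy, hz⟩ := hcon
  obtain ⟨ε₁, h₁, H₁⟩ := sep _ _ _ hx
  obtain ⟨ε₂, h₂, H₂⟩ := sep _ _ _ hy
  obtain ⟨ε₃, h₃, H₃⟩ := sep _ _ _ hz
  obtain ⟨f, hf, hfd⟩ := hX.exists_small_fibers (lt_min h₁ (lt_min h₂ h₃))
  have k₁ := H₁ f hf fun x y h => (hfd x y h).trans_le (min_le_left _ _)
  have k₂ := H₂ f hf fun x y h => (hfd x y h).trans_le ((min_le_right _ _).trans (min_le_left _ _))
  have k₃ := H₃ f hf fun x y h => (hfd x y h).trans_le ((min_le_right _ _).trans (min_le_right _ _))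
  simp only [mem_uIcc, not_or, not_and_or, not_le] at k₁ k₂ k₃
  grind

variable [ConnectedSpace X]

theorem IsArcLike.isSubcontinuum_hull (hX : IsArcLike X) (x y : X) :
    IsSubcontinuum (continuumHull x y) :=
  isSubcontinuum_continuumHull fun _ _ hC hD hxC hxD _ _ =>
    hX.isSubcontinuum_inter hC hD ⟨x, hxC, hxD⟩

theorem IsArcLike.hull_subset_hull (hX : IsArcLike X) {x y u v : X} (hu : u ∈ continuumHull x y)
    (hv : v ∈ continuumHull x y) : continuumHull u v ⊆ continuumHull x y :=
  continuumHull_subset (hX.isSubcontinuum_hull x y) hu hv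

theorem IsArcLike.hull_mono (hX : IsArcLike X) {p x y : X} (h : x ∈ continuumHull p y) :
    continuumHull p x ⊆ continuumHull p y :=
  hX.hull_subset_hull (left_mem_continuumHull p y) h

theorem IsArcLike.hull_subset_union (hX : IsArcLike X) (x y z : X) :
    continuumHull x y ⊆ continuumHull x z ∪ continuumHull z y :=
  continuumHull_subset ((hX.isSubcontinuum_hull x z).union (hX.isSubcontinuum_hull z y)
    ⟨z, right_mem_continuumHull x z, left_mem_continuumHull z y⟩)
    (Or.inl (left_mem_continuumHull x z)) (Or.inr (right_mem_continuumHull z y))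

end ArcLike

/-! ### Chains of hulls in arc-like continua -/

section Chains

/-- The closure of what remains of the hulls of `p` with the points of `S` after removing the
set `D` and the hull of `p` and `s`. -/
def hullTail {X : Type*} [TopologicalSpace X] (p : X) (S D : Set X) (s : X) : Set X :=
  closure (⋃ t ∈ S, continuumHull p t \ (D ∪ continuumHull p s))

theorem mem_hullTail {X : Type*} [TopologicalSpace X] {p : X} {S D : Set X} {s t x : X}
    (ht : t ∈ S) (hx : x ∈ continuumHull p t) (hxD : x ∉ D) (hxs : x ∉ continuumHull p s) :
    x ∈ hullTail p S D s :=
  subset_closure (mem_iUnion₂.2 ⟨t, ht, hx, fun h => h.elim hxD hxs⟩)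

variable {X : Type*} [MetricSpace X] [CompactSpace X] [ConnectedSpace X] {p : X} {S : Set X}

theorem IsArcLike.exists_notMem_hulls (hX : IsArcLike X)
    (hS : ∀ s ∈ S, ∀ t ∈ S, s ∈ continuumHull p t ∨ t ∈ continuumHull p s)
    (hub : ∀ e, ∃ s ∈ S, s ∉ continuumHull p e) {s t : X} (hs : s ∈ S) (ht : t ∈ S) :
    ∃ r ∈ S, r ∉ continuumHull p s ∧ r ∉ continuumHull p t ∧
      s ∈ continuumHull p r ∧ t ∈ continuumHull p r := by
  have key : ∀ s ∈ S, ∀ t ∈ S, t ∈ continuumHull p s → ∃ r ∈ S, r ∉ continuumHull p s ∧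
      r ∉ continuumHull p t ∧ s ∈ continuumHull p r ∧ t ∈ continuumHull p r := by
    intro s hs t ht hts
    obtain ⟨r, hr, hrs⟩ := hub s
    have hsr := (hS s hs r hr).resolve_right hrs
    exact ⟨r, hr, hrs, fun h => hrs (hX.hull_mono hts h), hsr, hX.hull_mono hsr hts⟩
  rcases hS s hs t ht with h | h
  · obtain ⟨r, hr, h1, h2, h3, h4⟩ := key t ht s hs h
    exact ⟨r, hr, h2, h1, h4, h3⟩
  · exact key s hs t ht h

theorem IsArcLike.hullTail_anti (hX : IsArcLike X) {D : Set X} {s t : X}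
    (h : s ∈ continuumHull p t) : hullTail p S D t ⊆ hullTail p S D s :=
  closure_mono (iUnion₂_mono fun _ _ => sdiff_subset_sdiff_right
    (union_subset_union_right _ (hX.hull_mono h)))

theorem IsArcLike.isSubcontinuum_hullTail (hX : IsArcLike X)
    (hS : ∀ s ∈ S, ∀ t ∈ S, s ∈ continuumHull p t ∨ t ∈ continuumHull p s)
    {D : Set X} (hD : IsSubcontinuum D) {s t z : X} (hzD : z ∈ D) (hzs : z ∈ continuumHull p s)
    (hs : s ∈ S) (ht : t ∈ S) (htD : t ∉ D) (hts : t ∉ continuumHull p s) :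
    IsSubcontinuum (hullTail p S D s) := by
  refine IsPreconnected.isSubcontinuum_closure ?_
    ⟨t, mem_iUnion₂.2 ⟨t, ht, right_mem_continuumHull p t, fun h => h.elim htD hts⟩⟩
  rw [← sUnion_image]
  refine IsPreconnected.sUnion_directed ?_ ?_
  · rintro _ ⟨u, hu, rfl⟩ _ ⟨v, hv, rfl⟩
    rcases hS u hu v hv with h | h
    · exact ⟨_, ⟨v, hv, rfl⟩, sdiff_subset_sdiff_left (hX.hull_mono h), subset_rfl⟩
    · exact ⟨_, ⟨u, hu, rfl⟩, subset_rfl, sdiff_subset_sdiff_left (hX.hull_mono h)⟩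
  · rintro _ ⟨u, hu, rfl⟩
    dsimp only
    rcases hS s hs u hu with h | h
    · have hsub := hX.hull_mono h
      have heq : continuumHull p u \ (D ∪ continuumHull p s) =
          continuumHull p u \ ((D ∩ continuumHull p u) ∪ continuumHull p s) := by
        ext x
        simp only [mem_sdiff, mem_union, mem_inter_iff]
        tauto
      rw [heq]
      refine isPreconnected_diff_of_irreducible (p := p) (s := u) (hX.isSubcontinuum_hull p u)
        (fun C hC hp hu => continuumHull_subset hC hp hu) (right_mem_continuumHull p u) ?_
        (union_subset inter_subset_right hsub) (Or.inr (left_mem_continuumHull p s))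
      exact (hX.isSubcontinuum_inter hD (hX.isSubcontinuum_hull p u) ⟨z, hzD, hsub hzs⟩).union
        (hX.isSubcontinuum_hull p s) ⟨z, ⟨hzD, hsub hzs⟩, hzs⟩
    · rw [sdiff_eq_empty.2 ((hX.hull_mono h).trans subset_union_right)]
      exact isPreconnected_empty

/-- Let `S` be a chain without an upper bound. A decreasing family of continua `G s` that contain
the points of `S` beyond `s` contains a tail of the union of the hulls. By compactness some `z`
lies in all `G s`, and it may be taken in one of the hulls: otherwise `p` lies between `z` and
the far points of `S`, so that `z` may be replaced by `p`. Between `z` and the far points of `S`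
lies everything beyond the hull that contains `z`. -/
theorem IsArcLike.exists_hullTail_subset (hX : IsArcLike X)
    (hS : ∀ s ∈ S, ∀ t ∈ S, s ∈ continuumHull p t ∨ t ∈ continuumHull p s)
    (hub : ∀ e, ∃ s ∈ S, s ∉ continuumHull p e) {c : X} (hc : c ∈ S) {G : X → Set X}
    (hG : ∀ s ∈ S, c ∈ continuumHull p s → IsSubcontinuum (G s))
    (hanti : ∀ s ∈ S, ∀ t ∈ S, s ∈ continuumHull p t → G t ⊆ G s)
    (hmem : ∀ s ∈ S, ∀ t ∈ S, c ∈ continuumHull p s → t ∉ continuumHull p s → t ∈ G s) :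
    ∃ r ∈ S, ∀ s ∈ S, c ∈ continuumHull p s → hullTail p S {p} r ⊆ G s := by
  let I := {s : X // s ∈ S ∧ c ∈ continuumHull p s}
  have : Nonempty I := ⟨c, hc, right_mem_continuumHull p c⟩
  obtain ⟨z, hz⟩ := IsCompact.nonempty_iInter_of_directed_nonempty_isCompact_isClosed
    (fun s : I => G s)
    (fun s t => (hS s s.2.1 t t.2.1).elim
      (fun h => ⟨t, hanti s s.2.1 t t.2.1 h, subset_rfl⟩)
      (fun h => ⟨s, subset_rfl, hanti t t.2.1 s s.2.1 h⟩))
    (fun s => (hG s s.2.1 s.2.2).2.nonempty) (fun s => (hG s s.2.1 s.2.2).1)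
    (fun s => (hG s s.2.1 s.2.2).isClosed)
  rw [mem_iInter] at hz
  obtain ⟨z, r, hr, hzr, hz⟩ : ∃ z, ∃ r ∈ S, z ∈ continuumHull p r ∧ ∀ s : I, z ∈ G s := by
    by_cases hzS : ∃ r ∈ S, z ∈ continuumHull p r
    · obtain ⟨r, hr, hzr⟩ := hzS
      exact ⟨z, r, hr, hzr, hz⟩
    · refine ⟨p, c, hc, left_mem_continuumHull p c, fun s => ?_⟩
      obtain ⟨u, hu, huz⟩ := hub z
      obtain ⟨t, ht, hts, -, -, hut⟩ := hX.exists_notMem_hulls hS hub s.2.1 hu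
      rcases hX.mem_hull_or p z t with h | h | h
      · exact continuumHull_subset (hG s s.2.1 s.2.2) (hz s) (hmem s s.2.1 t ht s.2.2 hts) h
      · exact absurd ⟨t, ht, h⟩ hzS
      · exact absurd (hX.hull_mono h hut) huz
  refine ⟨r, hr, fun s hs hcs => closure_minimal (iUnion₂_subset fun t ht => ?_)
    (hG s hs hcs).isClosed⟩
  rintro x ⟨hxt, hx⟩
  obtain ⟨u, hu, hus, -, -, htu⟩ := hX.exists_notMem_hulls hS hub hs ht
  have hxu := (hX.hull_subset_union p u z (hX.hull_mono htu hxt)).resolve_left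
    fun h => hx (Or.inr (hX.hull_mono hzr h))
  exact continuumHull_subset (hG s hs hcs) (hz ⟨s, hs, hcs⟩) (hmem s hs u hu hcs hus) hxu

/-- If every point of a subcontinuum `F` lies together with `z` in a proper subcontinuum of
`F`, then some proper subcontinuum of `F` through `z` has interior in `F`. -/
theorem IsArcLike.exists_subcontinuum_interior (hX : IsArcLike X) {F : Set X}
    (hF : IsSubcontinuum F) {z : X} (hzF : z ∈ F)
    (hproper : ∀ w ∈ F, ¬ F ⊆ continuumHull z w) :
    ∃ D O : Set X, IsSubcontinuum D ∧ z ∈ D ∧ ¬ F ⊆ D ∧ IsOpen O ∧ (O ∩ F).Nonempty ∧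
      O ∩ F ⊆ D := by
  -- `D U` is the greatest subcontinuum of `F` through `z` that misses the basic open
  -- set `U`, if there is one, and empty otherwise.
  let D : Set X → Set X := fun U =>
    closure (⋃₀ {C | ∃ w ∈ F, C = continuumHull z w ∧ Disjoint U C})
  have : CompactSpace F := isCompact_iff_compactSpace.1 hF.1
  have : Nonempty F := ⟨z, hzF⟩
  let ι := {U : Set X // U ∈ TopologicalSpace.countableBasis X ∧ (U ∩ F).Nonempty}
  have : Countable ι := ((TopologicalSpace.countable_countableBasis X).mono
    (fun U hU => hU.1 : {U | U ∈ TopologicalSpace.countableBasis X ∧ (U ∩ F).Nonempty} ⊆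
      TopologicalSpace.countableBasis X)).to_subtype
  obtain ⟨⟨U, hU, y, hyU, hyF⟩, x, hx⟩ := nonempty_interior_of_iUnion_of_closed
    (f := fun U : ι => ((↑) ⁻¹' D U : Set F))
    (fun U => isClosed_closure.preimage continuous_subtype_val) (by
      refine eq_univ_of_forall fun w => mem_iUnion.2 ?_
      obtain ⟨y, hyF, hy⟩ := not_subset.1 (hproper w w.2)
      obtain ⟨U, hU, hyU, hUsub⟩ :=
        (TopologicalSpace.isBasis_countableBasis X).exists_subset_of_mem_open hy
          (hX.isSubcontinuum_hull z w).isClosed.isOpen_compl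
      exact ⟨⟨U, hU, y, hyU, hyF⟩, subset_closure ⟨_, ⟨w, w.2, rfl, disjoint_left.2 hUsub⟩,
        right_mem_continuumHull z w⟩⟩)
  obtain ⟨O, hO, hOx⟩ := isOpen_induced_iff.1
    (isOpen_interior (s := ((↑) ⁻¹' D U : Set F)))
  have hxD : (x : X) ∈ D U := interior_subset (s := ((↑) ⁻¹' D U : Set F)) hx
  obtain ⟨w, C, ⟨v, hv, rfl, hUC⟩, -⟩ := closure_nonempty_iff.1 ⟨_, hxD⟩
  refine ⟨D U, O, IsPreconnected.isSubcontinuum_closure ?_ (closure_nonempty_iff.1 ⟨_, hxD⟩),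
    subset_closure ⟨_, ⟨v, hv, rfl, hUC⟩, left_mem_continuumHull z v⟩, fun hFD => ?_, hO,
    ⟨x, ?_, x.2⟩, ?_⟩
  · refine isPreconnected_sUnion z _ ?_ ?_
    · rintro _ ⟨w, -, rfl, -⟩
      exact left_mem_continuumHull z w
    · rintro _ ⟨w, -, rfl, -⟩
      exact (hX.isSubcontinuum_hull z w).isPreconnected
  · obtain ⟨u, huU, C, ⟨w, hw, -, hdis⟩, huC⟩ := mem_closure_iff.1 (hFD hyF) U
      (TopologicalSpace.isOpen_of_mem_countableBasis hU) hyU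
    exact disjoint_left.1 hdis huU huC
  · rw [← hOx] at hx
    exact hx
  · rintro u ⟨huO, huF⟩
    have : (⟨u, huF⟩ : F) ∈ interior ((↑) ⁻¹' D U : Set F) := by
      rw [← hOx]
      exact huO
    exact interior_subset (s := ((↑) ⁻¹' D U : Set F)) this

/-- Every chain of hulls with `p` is bounded. For an unbounded chain all tails of its union have
eventually the same closure `F`, which behaves like an indecomposable continuum: a proper
subcontinuum through a suitable point `z` has no interior in `F`. By Baire's theorem `F` is the
hull of `z` and a point `w`, and `w` turns out to be an upper bound. -/
theorem IsArcLike.exists_upper_bound (hX : IsArcLike X)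
    (hS : ∀ s ∈ S, ∀ t ∈ S, s ∈ continuumHull p t ∨ t ∈ continuumHull p s) :
    ∃ e, ∀ s ∈ S, s ∈ continuumHull p e := by
  by_contra! hub
  obtain ⟨c, hc, -⟩ := hub p
  have hcof := fun {s t : X} => hX.exists_notMem_hulls hS hub (s := s) (t := t)
  have htail : ∀ s ∈ S, ∀ t ∈ S, t ∉ continuumHull p s → t ∈ hullTail p S {p} s :=
    fun s _ t ht hts => mem_hullTail ht (right_mem_continuumHull p t)
      (fun h => hts (mem_singleton_iff.1 h ▸ left_mem_continuumHull p s)) hts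
  have hsubc : ∀ s ∈ S, IsSubcontinuum (hullTail p S {p} s) := by
    intro s hs
    obtain ⟨t, ht, hts, -⟩ := hcof hs hs
    exact hX.isSubcontinuum_hullTail hS (isSubcontinuum_singleton p) rfl
      (left_mem_continuumHull p s) hs ht
      (fun h => hts (mem_singleton_iff.1 h ▸ left_mem_continuumHull p s)) hts
  obtain ⟨r, hr, hrs⟩ := hX.exists_hullTail_subset hS hub hc (G := hullTail p S {p})
    (fun s hs _ => hsubc s hs) (fun s _ t _ h => hX.hullTail_anti h)
    (fun s hs t ht _ h => htail s hs t ht h)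
  set F := hullTail p S {p} r with hFdef
  have hFtail : ∀ s ∈ S, F ⊆ hullTail p S {p} s := by
    intro s hs
    obtain ⟨t, ht, -, -, hct, hst⟩ := hcof hc hs
    exact (hrs t ht hct).trans (hX.hullTail_anti hst)
  have hF := hsubc r hr
  obtain ⟨z, hzF, k, hk, hzk, hpz⟩ : ∃ z ∈ F, ∃ k ∈ S, z ∈ continuumHull p k ∧ (p ∈ F → z = p) := by
    by_cases hpF : p ∈ F
    · exact ⟨p, hpF, c, hc, left_mem_continuumHull p c, fun _ => rfl⟩
    obtain ⟨z, hz⟩ := hF.2.nonempty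
    obtain ⟨u, hu, huz⟩ := hub z
    obtain ⟨t, ht, htr, -, -, hut⟩ := hcof hr hu
    refine ⟨z, hz, t, ht, ?_, fun h => absurd h hpF⟩
    rcases hX.mem_hull_or p z t with h | h | h
    · exact absurd (continuumHull_subset hF hz (htail r hr t ht htr) h) hpF
    · exact h
    · exact absurd (hX.hull_mono h hut) huz
  have hkey : ∀ G, IsSubcontinuum G → z ∈ G → (∀ s ∈ S, ∃ t ∈ S, s ∈ continuumHull p t ∧ t ∈ G) →
      F ⊆ G := by
    intro G hG hzG hcofG
    refine (hFtail k hk).trans (closure_minimal (iUnion₂_subset fun t ht => ?_) hG.isClosed)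
    rintro x ⟨hxt, hx⟩
    obtain ⟨u, hu, htu, huG⟩ := hcofG t ht
    exact continuumHull_subset hG hzG huG
      ((hX.hull_subset_union p u z (hX.hull_mono htu hxt)).resolve_left
        fun h => hx (Or.inr (hX.hull_mono hzk h)))
  have hproper : ∀ w ∈ F, ¬ F ⊆ continuumHull z w := by
    intro w hw hFw
    have hnot : ¬ F ⊆ continuumHull p w := by
      intro hFpw
      obtain ⟨s, hs, hsw⟩ := hub w
      obtain ⟨t, ht, htr, -, -, hst⟩ := hcof hr hs
      exact hsw (hX.hull_mono (hFpw (htail r hr t ht htr)) hst)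
    rcases hX.mem_hull_or p z w with h | h | h
    · exact hnot (hpz (continuumHull_subset hF hzF hw h) ▸ hFw)
    · exact hnot (hFw.trans (hX.hull_subset_hull h (right_mem_continuumHull p w)))
    · obtain ⟨t, ht, htr, htk, -⟩ := hcof hr hk
      exact htk (hX.hull_mono hzk (hX.hull_subset_hull (right_mem_continuumHull p z) h
        (hFw (htail r hr t ht htr))))
  obtain ⟨D, O, hD, hzD, hFD, hO, ⟨y, hyO, hyF⟩, hOD⟩ :=
    hX.exists_subcontinuum_interior hF hzF hproper
  -- The points of the chain eventually avoid `D`, so removing `D` from the tails of the union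
  -- leaves connected sets with the same closure `F`, although `D` has interior in `F`.
  obtain ⟨m, hm, hmD⟩ : ∃ m ∈ S, ∀ t ∈ S, m ∈ continuumHull p t → t ∉ D := by
    by_contra! hcon
    exact hFD (hkey D hD hzD hcon)
  obtain ⟨j, hj, -, -, hkj, hmj⟩ := hcof hk hm
  have hbeyond : ∀ s ∈ S, ∀ t ∈ S, j ∈ continuumHull p s → t ∉ continuumHull p s → t ∉ D :=
    fun s hs t ht hjs hts => hmD t ht (hX.hull_mono ((hS s hs t ht).resolve_right hts)
      (hX.hull_mono hjs hmj))
  obtain ⟨i, hi, hiG⟩ := hX.exists_hullTail_subset hS hub hj (G := hullTail p S D)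
    (fun s hs hjs => by
      obtain ⟨t, ht, hts, -⟩ := hcof hs hs
      exact hX.isSubcontinuum_hullTail hS hD hzD (hX.hull_mono hjs (hX.hull_mono hkj hzk)) hs ht
        (hbeyond s hs t ht hjs hts) hts)
    (fun s _ t _ h => hX.hullTail_anti h)
    (fun s hs t ht hjs hts => mem_hullTail ht (right_mem_continuumHull p t)
      (hbeyond s hs t ht hjs hts) hts)
  obtain ⟨s, hs, -, -, hjs, hrs⟩ := hcof hj hr
  obtain ⟨x, hxO, hx⟩ := mem_closure_iff.1 (hiG s hs hjs (hFtail i hi hyF)) O hO hyO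
  obtain ⟨t, ht, hxt, hx⟩ := mem_iUnion₂.1 hx
  have hxs : x ∉ continuumHull p s := fun h => hx (Or.inr h)
  have hxF : x ∈ F := mem_hullTail ht hxt
    (fun h => hxs (mem_singleton_iff.1 h ▸ left_mem_continuumHull p s))
    (fun h => hxs (hX.hull_mono hrs h))
  exact hx (Or.inl (hOD ⟨hxO, hxF⟩))

theorem IsArcLike.exists_maximal (hX : IsArcLike X) (p : X) :
    ∃ m, ∀ y, m ∈ continuumHull p y → y ∈ continuumHull p m := by
  refine exists_maximal_of_chains_bounded (r := fun x y => x ∈ continuumHull p y)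
    (fun S hS => hX.exists_upper_bound fun s hs t ht => ?_)
    (fun hxy hyz => hX.hull_mono hyz hxy)
  by_cases hst : s = t
  · exact Or.inl (hst ▸ right_mem_continuumHull p s)
  · exact hS hs ht hst

/-- Arc-like continua are irreducible: a point `m` that is farthest from some point `p`, and a
point `m'` that is farthest from `m`, are contained in no proper subcontinuum. -/
theorem IsArcLike.isIrreducibleContinuum [Nontrivial X] (hX : IsArcLike X) :
    IsIrreducibleContinuum X := by
  obtain ⟨p⟩ : Nonempty X := inferInstance
  obtain ⟨m, hm⟩ := hX.exists_maximal p
  obtain ⟨m', hm'⟩ := hX.exists_maximal m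
  have hp : p ∈ continuumHull m m' := by
    rcases hX.mem_hull_or p m m' with h | h | h
    · exact h
    · have := hm m' h
      rw [continuumHull_comm] at this
      exact hm' p this
    · rw [continuumHull_comm] at h
      exact hm' p h
  have hall : ∀ y, y ∈ continuumHull m m' := by
    intro y
    have hpm : ∀ y, y ∈ continuumHull p m → y ∈ continuumHull m m' := fun y h =>
      hX.hull_subset_hull hp (left_mem_continuumHull m m') h
    rcases hX.mem_hull_or y m m' with h | h | h
    · exact h
    · rcases hX.mem_hull_or p m y with k | k | k
      · -- Here `p` lies between `m` and `y`, and `m` lies between `y` and `m'`.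
        rcases hX.hull_subset_union y m' p h with l | l
        · rw [continuumHull_comm] at l
          exact hpm y (hm y l)
        · have := hm m' l
          rw [continuumHull_comm] at this
          exact hm' y (hX.hull_mono k this)
      · exact hpm y (hm y k)
      · exact hpm y k
    · rw [continuumHull_comm] at h
      exact hm' y h
  refine ⟨m, m', fun heq => ?_, fun C hC hmC hmC' =>
    eq_univ_of_forall fun y => continuumHull_subset hC hmC hmC' (hall y)⟩
  obtain ⟨y, hy⟩ := exists_ne m
  have := hall y
  rw [← heq, continuumHull_self] at this
  exact hy this

end Chains

/-! ### The equivalence -/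

theorem corollary3p3 {X : Type*} [MetricSpace X] [CompactSpace X] [ConnectedSpace X]
    [Nontrivial X] :
    List.TFAE
      [IsIrreducibleContinuum X ∧ IsWilderContinuum X,
       IsIrreducibleContinuum X ∧ IsDStarContinuum X,
       IsIrreducibleContinuum X ∧ IsDStarStarContinuum X,
       IsArc X] ∧
    (IsArcLike X → IsDStarContinuum X → IsArc X) := by
  refine ⟨?_, fun hX hD => isArc_of_irreducible_of_dStarStar hX.isIrreducibleContinuum
    hD.isDStarStarContinuum⟩
  tfae_have 1 → 3 := fun h => ⟨h.1, h.2.isDStarStarContinuum⟩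
  tfae_have 2 → 3 := fun h => ⟨h.1, h.2.isDStarStarContinuum⟩
  tfae_have 3 → 4 := fun h => isArc_of_irreducible_of_dStarStar h.1 h.2
  tfae_have 4 → 1 := fun h => ⟨h.isIrreducibleContinuum, h.isWilderContinuum⟩
  tfae_have 4 → 2 := fun h => ⟨h.isIrreducibleContinuum, h.isDStarContinuum⟩
  tfae_finish
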